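/- Let $d\ge 1$, $\tau>d/2$, $\sigma\in(\frac{d}{2\tau},1]$ and $\Omega\subset\mathbb{R}^d$. Let $\|\cdot\|$ denote the Euclidean norm and use the Fourier transform $\hat\Phi(\omega)=(2\pi)^{-d/2}\int_{\mathbb{R}^d}\Phi(x)e^{-i\omega^\top x}\,dx$. Let $k(x,z)=\Phi(x-z)$ and $k^{(\sigma)}(x,z)=\Phi^{(\sigma)}(x-z)$ be the translation invariant kernels on $\mathbb{R}^d$, with $\Phi,\Phi^{(\sigma)}:\mathbb{R}^d\to\mathbb{R}$ continuous and integrable, whose Fourier transforms are $$\hat\Phi(\omega)=(1+\|\omega\|^2)^{-\tau},\qquad \hat\Phi^{(\sigma)}(\omega)=(1+\|\omega\|^2)^{-\sigma\tau}\qquad\text{for all }\omega\in\mathbb{R}^d.$$ For a finite set $X=\{x_1,\dots,x_N\}\subset\Omega$ of pairwise distinct points let $A=k(X,X)=(k(x_i,x_j))_{i,j}$ and $A^{(\sigma)}=k^{(\sigma)}(X,X)$ be the kernel matrices, and for $N\ge2$ let $q_X=\min_{i\ne j}\|x_i-x_j\|$ be the separation distance. Let $c_0=\sqrt2\,\lambda_{\min}(-\Delta)^{1/2}$,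 where $\lambda_{\min}(-\Delta)$ is the smallest eigenvalue of the Dirichlet Laplace operator on the ball $B_{1/2}(0)\subset\mathbb{R}^d$. Then there is a constant $c_\sigma>0$, depending only on $\sigma,d,\tau,\Omega$, such that for every such $X$ and every $0\ne\alpha\in\mathbb{R}^N$ $$\frac{\alpha^\top A\alpha}{\|\alpha\|^2}\le\frac{\alpha^\top A^{(\sigma)}\alpha}{\|\alpha\|^2},$$ and, if $N\ge2$, $$\frac{\alpha^\top A^{(\sigma)}\alpha}{\|\alpha\|^2}\le c_\sigma\,(q_X^2+c_0^2)^{(1-\sigma)\tau}\,q_X^{-2(1-\sigma)\tau}\,\frac{\alpha^\top A\alpha}{\|\alpha\|^2}.$$ If $\Omega$ is moreover bounded, then there is a constant $c'_\sigma>0$, depending only on $\sigma,d,\tau,\Omega$, such that for every such $X$ with $N\ge 2$ and every $0\neq\alpha\in\mathbb{R}^N$ $$\frac{\alpha^\top A\alpha}{\|\alpha\|^2}\le\frac{\alpha^\top A^{(\sigma)}\alpha}{\|\alpha\|^2}\le c'_\sigma\,q_X^{-2(1-\sigma)\tau}\,\frac{\alpha^\top A\alpha}{\|\alpha\|^2}.$$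 -/

import Mathlib

/-- The Fourier transform on `ℝᵈ` in the unitary angular-frequency normalization:
`Φ̂(ω) = (2π)^(-d/2) ∫ Φ(x) exp(-i ωᵀx) dx`. -/
noncomputable def fourierSymbol {d : ℕ} (Φ : EuclideanSpace ℝ (Fin d) → ℝ)
    (ω : EuclideanSpace ℝ (Fin d)) : ℂ :=
  (((2 * Real.pi) ^ (-(d : ℝ) / 2) : ℝ) : ℂ) *
    ∫ x, Complex.exp (-(Complex.I * ((inner ℝ ω x : ℝ) : ℂ))) * ((Φ x : ℝ) : ℂ)

/-- `k` is translation invariant, `k(x, z) = Φ(x - z)`, with `Φ` continuous and integrable and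
`Φ̂(ω) = (1 + ‖ω‖²)^(-s)` for every `ω`. -/
def IsSobolevKernel {d : ℕ}
    (k : EuclideanSpace ℝ (Fin d) → EuclideanSpace ℝ (Fin d) → ℝ) (s : ℝ) : Prop :=
  ∃ Φ : EuclideanSpace ℝ (Fin d) → ℝ,
    Continuous Φ ∧ MeasureTheory.Integrable Φ ∧
    (∀ x z, k x z = Φ (x - z)) ∧
    ∀ ω, fourierSymbol Φ ω = (((1 + ‖ω‖ ^ 2) ^ (-s) : ℝ) : ℂ)

/-- The kernel matrix `k(X, X)` of the points `X = {x₁, …, x_N}`. -/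
def kernelMatrix {d N : ℕ}
    (k : EuclideanSpace ℝ (Fin d) → EuclideanSpace ℝ (Fin d) → ℝ)
    (x : Fin N → EuclideanSpace ℝ (Fin d)) : Matrix (Fin N) (Fin N) ℝ :=
  Matrix.of fun i j => k (x i) (x j)

/-- The Rayleigh quotient `αᵀ A α / ‖α‖²` (Euclidean norm). -/
noncomputable def rayleigh {N : ℕ} (A : Matrix (Fin N) (Fin N) ℝ)
    (α : EuclideanSpace ℝ (Fin N)) : ℝ :=
  (α.ofLp ⬝ᵥ Matrix.mulVec A α.ofLp) / ‖α‖ ^ 2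

/-- The separation distance `q_X`: the minimal distance between two distinct points. For two or
more points the set is finite and nonempty, so that the infimum is a minimum. -/
noncomputable def sepDist {d N : ℕ} (x : Fin N → EuclideanSpace ℝ (Fin d)) : ℝ :=
  sInf {r : ℝ | ∃ i j : Fin N, x i ≠ x j ∧ r = ‖x i - x j‖}

/-- The smallest eigenvalue of the Dirichlet Laplacian `-Δ` on the ball `B_{1/2}(0) ⊆ ℝᵈ`, by the
Rayleigh-Ritz principle: the infimum of `∫ ‖∇u‖² / ∫ u²` over the nonzero smooth functions with
compact support in the ball (a dense subspace of `H¹₀`). The norm of `fderiv ℝ u x` is the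
Euclidean norm of the gradient. -/
noncomputable def dirichletEigenvalue (d : ℕ) : ℝ :=
  sInf {r : ℝ | ∃ u : EuclideanSpace ℝ (Fin d) → ℝ,
    ContDiff ℝ (⊤ : ℕ∞) u ∧ HasCompactSupport u ∧
    tsupport u ⊆ Metric.ball (0 : EuclideanSpace ℝ (Fin d)) (1 / 2) ∧ u ≠ 0 ∧
    r = (∫ x, ‖fderiv ℝ u x‖ ^ 2) / ∫ x, u x ^ 2}

/-- The dimensional constant `c₀ = √2 λ_min(-Δ)^{1/2}`. -/
noncomputable def c0 (d : ℕ) : ℝ := Real.sqrt 2 * Real.sqrt (dirichletEigenvalue d)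

open MeasureTheory Real FourierTransform
open scoped SchwartzMap

/-! Fourier inversion turns `αᵀAα` into `(2π)^(d/2) ∫ w |S|²`, where `S` is the exponential sum with
coefficients `α` and nodes `X`, and `w` is the Sobolev weight of order `τ` or `στ`. The lower bound
is then the pointwise monotonicity of the weight in its order.

The upper bound is a Bernstein-type inequality, `exists_integral_sobolevWeight_le`: at node
separation `δ ≤ 1`, the frequencies beyond `1/δ` are controlled by the others. On `‖δξ‖ ≤ M` the two
weights differ by at most a constant times `δ^(-2(1-σ)τ)`. The tail is removed by
`exists_bandlimited_profile`: some `G` dominates `‖ξ‖^(-2s)` far out, is bounded below, and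
satisfies `∫ G |S|² = 0` for every sum with 1-separated nodes. Adding a multiple of `G(δξ)` to the
weight thus costs nothing.

This gives the factor `min(q_X, 1)^(-2(1-σ)τ)`. The stated form with `c₀` follows from `c₀ ≥ 1`, a
consequence of Poincaré's inequality. -/

/-! ### Exponential sums and Plancherel for separated nodes. -/

/-- The exponential sum `ξ ↦ ∑ⱼ βⱼ exp(2πi ⟨ξ, xⱼ⟩)`. -/
noncomputable def expSum {d N : ℕ} (β : Fin N → ℂ) (x : Fin N → EuclideanSpace ℝ (Fin d))
    (ξ : EuclideanSpace ℝ (Fin d)) : ℂ :=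
  ∑ j, β j * (𝐞 (inner ℝ ξ (x j)) : ℂ)

theorem continuous_expSum {d N : ℕ} (β : Fin N → ℂ) (x : Fin N → EuclideanSpace ℝ (Fin d)) :
    Continuous (expSum β x) := by
  unfold expSum
  refine continuous_finsetSum _ fun j _ => continuous_const.mul ?_
  exact continuous_subtype_val.comp (Real.continuous_fourierChar.comp (by fun_prop))

theorem norm_expSum_le {d N : ℕ} (β : Fin N → ℂ) (x : Fin N → EuclideanSpace ℝ (Fin d))
    (ξ : EuclideanSpace ℝ (Fin d)) : ‖expSum β x ξ‖ ≤ ∑ j, ‖β j‖ := by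
  refine (norm_sum_le _ _).trans (le_of_eq ?_)
  simp only [norm_mul, Circle.norm_coe, mul_one]

theorem expSum_add {d N : ℕ} (β : Fin N → ℂ) (x : Fin N → EuclideanSpace ℝ (Fin d))
    (ξ η : EuclideanSpace ℝ (Fin d)) :
    expSum β x (ξ + η) = expSum (fun j => β j * (𝐞 (inner ℝ η (x j)) : ℂ)) x ξ := by
  unfold expSum
  refine Finset.sum_congr rfl fun j _ => ?_
  rw [inner_add_left, AddChar.map_add_eq_mul, Circle.coe_mul]
  ring

theorem expSum_smul {d N : ℕ} (β : Fin N → ℂ) (x : Fin N → EuclideanSpace ℝ (Fin d))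
    (r : ℝ) (ξ : EuclideanSpace ℝ (Fin d)) :
    expSum β x (r • ξ) = expSum β (fun j => r • x j) ξ := by
  simp [expSum, real_inner_smul_left, real_inner_smul_right]

theorem MeasureTheory.Integrable.mul_norm_expSum_sq {d N : ℕ}
    {w : EuclideanSpace ℝ (Fin d) → ℝ} (hw : Integrable w)
    (β : Fin N → ℂ) (x : Fin N → EuclideanSpace ℝ (Fin d)) :
    Integrable fun ξ => w ξ * ‖expSum β x ξ‖ ^ 2 := by
  refine hw.mul_bdd (c := (∑ j, ‖β j‖) ^ 2)
    ((continuous_expSum β x).norm.pow 2).aestronglyMeasurable (.of_forall fun ξ => ?_)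
  rw [Real.norm_of_nonneg (by positivity)]
  exact pow_le_pow_left₀ (norm_nonneg _) (norm_expSum_le β x ξ) 2

/-- Plancherel's identity for exponential sums with `1`-separated nodes. -/
theorem integral_norm_fourier_sq_mul_norm_expSum_sq {d N : ℕ}
    (χ : 𝓢(EuclideanSpace ℝ (Fin d), ℂ))
    (hχ : ∀ z, 1 / 2 ≤ ‖z‖ → χ z = 0)
    (β : Fin N → ℂ) (y : Fin N → EuclideanSpace ℝ (Fin d))
    (hy : ∀ i j, i ≠ j → 1 ≤ ‖y i - y j‖) :
    ∫ ξ, ‖𝓕 χ ξ‖ ^ 2 * ‖expSum β y ξ‖ ^ 2 = (∫ z, ‖χ z‖ ^ 2) * ∑ j, ‖β j‖ ^ 2 := by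
  -- A superposition of translates of `χ`; its Fourier transform is the exponential sum times `𝓕 χ`.
  let f : 𝓢(EuclideanSpace ℝ (Fin d), ℂ) :=
    ∑ j, β j • SchwartzMap.compSubConstCLM ℂ (-y j) χ
  have hf : ∀ z, f z = ∑ j, β j * χ (z + y j) := fun z => by
    simp [f]
  have hF : ∀ ξ, 𝓕 f ξ = expSum β y ξ * 𝓕 χ ξ := fun ξ => by
    rw [SchwartzMap.fourier_coe, SchwartzMap.fourier_coe, Real.fourier_eq]
    have h1 : ∀ j, ∫ z, 𝐞 (-inner ℝ z ξ) • χ (z + y j)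
        = (𝐞 (inner ℝ ξ (y j)) : ℂ) * 𝓕 (χ : EuclideanSpace ℝ (Fin d) → ℂ) ξ := fun j => by
      rw [Real.fourier_eq,
        ← integral_add_right_eq_self (fun z => 𝐞 (-inner ℝ z ξ) • χ z) (y j),
        ← integral_const_mul]
      refine integral_congr_ae (.of_forall fun z => ?_)
      simp only [Circle.smul_def, smul_eq_mul]
      rw [← mul_assoc, ← Circle.coe_mul, ← AddChar.map_add_eq_mul, inner_add_left,
        real_inner_comm ξ (y j)]
      congr 3
      ring_nf
    have h2 : ∀ j, Integrable fun z => 𝐞 (-inner ℝ z ξ) • χ (z + y j) := fun j =>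
      (Real.fourierIntegral_convergent_iff ξ).2 (χ.integrable.comp_add_right (y j))
    simp_rw [hf, expSum, Finset.smul_sum, Finset.sum_mul]
    rw [integral_finsetSum]
    · refine Finset.sum_congr rfl fun j _ => ?_
      rw [mul_assoc, ← h1, ← integral_const_mul]
      refine integral_congr_ae (.of_forall fun z => ?_)
      simp only [Circle.smul_def, smul_eq_mul]
      ring
    · intro j _
      refine ((h2 j).const_mul (β j)).congr (.of_forall fun z => ?_)
      simp only [Circle.smul_def, smul_eq_mul]
      ring
  -- No cross terms: two translates that are both nonzero at `z` would have nodes at distance less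
  -- than 1.
  have hsq : ∀ z, ‖f z‖ ^ 2 = ∑ j, ‖β j‖ ^ 2 * ‖χ (z + y j)‖ ^ 2 := fun z => by
    rw [hf]
    by_cases h : ∃ i, χ (z + y i) ≠ 0
    · obtain ⟨i, hi⟩ := h
      have h0 : ∀ j, j ≠ i → χ (z + y j) = 0 := fun j hj => by
        apply hχ
        by_contra! hlt
        have hi' : ‖z + y i‖ < 1 / 2 := by
          by_contra! h'
          exact hi (hχ _ h')
        have := norm_sub_le (z + y j) (z + y i)
        rw [add_sub_add_left_eq_sub] at this
        linarith [hy j i hj]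
      rw [Finset.sum_eq_single i, Finset.sum_eq_single i, norm_mul, mul_pow]
      · intro j _ hj
        simp [h0 j hj]
      · simp
      · intro j _ hj
        simp [h0 j hj]
      · simp
    · push Not at h
      simp [h]
  have hP := SchwartzMap.integral_norm_sq_fourier f
  simp_rw [hF, hsq, norm_mul, mul_pow] at hP
  have hint : Integrable fun z => ‖χ z‖ ^ 2 := by
    have := (χ.memLp 2).integrable_norm_pow (by norm_num)
    simpa using this
  rw [integral_finsetSum _ fun j _ => (hint.comp_add_right (y j)).const_mul _] at hP
  simp_rw [integral_const_mul] at hP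
  rw [mul_comm, Finset.sum_mul]
  simp_rw [mul_comm (‖𝓕 χ _‖ ^ 2)]
  rw [hP]
  refine Finset.sum_congr rfl fun j _ => ?_
  rw [integral_add_right_eq_self (fun z => ‖χ z‖ ^ 2) (y j)]

/-! ### Quadratic forms of kernel matrices as weighted integrals. -/

/-- The Sobolev weight `ξ ↦ (1 + ‖2πξ‖²)^(-s)` in the ordinary-frequency variable. -/
noncomputable def sobolevWeight {d : ℕ} (s : ℝ) (ξ : EuclideanSpace ℝ (Fin d)) : ℝ :=
  (1 + ‖(2 * π) • ξ‖ ^ 2) ^ (-s)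

theorem sobolevWeight_nonneg {d : ℕ} (s : ℝ) (ξ : EuclideanSpace ℝ (Fin d)) :
    0 ≤ sobolevWeight s ξ :=
  Real.rpow_nonneg (by positivity) _

theorem integrable_one_add_norm_sq_rpow {d : ℕ} {s : ℝ} (hs : (d : ℝ) / 2 < s) :
    Integrable fun ξ : EuclideanSpace ℝ (Fin d) => (1 + ‖ξ‖ ^ 2) ^ (-s) := by
  have := integrable_rpow_neg_one_add_norm_sq (E := EuclideanSpace ℝ (Fin d)) (μ := volume)
    (r := 2 * s) (by rw [finrank_euclideanSpace_fin]; linarith)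
  convert this using 3
  ring

theorem integrable_sobolevWeight {d : ℕ} {s : ℝ} (hs : (d : ℝ) / 2 < s) :
    Integrable (sobolevWeight s : EuclideanSpace ℝ (Fin d) → ℝ) :=
  (integrable_one_add_norm_sq_rpow hs).comp_smul (by positivity : (2 * π) ≠ 0)

/-- Fourier inversion, available because `s > d/2` makes the weight integrable. Evaluating the
symbol at `2πξ` passes from angular to ordinary frequency and leaves the factor `(2π)^(d/2)`. -/
theorem IsSobolevKernel.apply_eq_integral {d : ℕ} {s : ℝ} (hs : (d : ℝ) / 2 < s)
    {k : EuclideanSpace ℝ (Fin d) → EuclideanSpace ℝ (Fin d) → ℝ} (hk : IsSobolevKernel k s)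
    (x z : EuclideanSpace ℝ (Fin d)) :
    (k x z : ℂ) = (((2 * π) ^ ((d : ℝ) / 2) : ℝ) : ℂ) *
      ∫ ξ, (sobolevWeight s ξ : ℂ) * (𝐞 (inner ℝ ξ (x - z)) : ℂ) := by
  obtain ⟨Φ, hc, hi, hΦ, hF⟩ := hk
  have hF' : 𝓕 (fun y => (Φ y : ℂ)) = fun ξ =>
      (((2 * π) ^ ((d : ℝ) / 2) : ℝ) : ℂ) * (sobolevWeight s ξ : ℂ) := by
    ext ξ
    have h := hF ((2 * π) • ξ)
    rw [sobolevWeight, ← h, fourierSymbol, ← mul_assoc, ← Complex.ofReal_mul,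
      ← Real.rpow_add (by positivity), Real.fourier_eq]
    have : (d : ℝ) / 2 + -(d : ℝ) / 2 = 0 := by ring
    rw [this, Real.rpow_zero, Complex.ofReal_one, one_mul]
    refine integral_congr_ae (.of_forall fun y => ?_)
    simp only [Circle.smul_def, smul_eq_mul, Real.fourierChar_apply]
    congr 2
    rw [real_inner_smul_left, real_inner_comm]
    push_cast
    ring
  have hint : Integrable (𝓕 (fun y => (Φ y : ℂ))) := by
    rw [hF']
    exact (integrable_sobolevWeight hs).ofReal.const_mul _
  have := congrFun (Continuous.fourierInv_fourier_eq (Complex.continuous_ofReal.comp hc)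
    hi.ofReal hint) (x - z)
  rw [hΦ, ← integral_const_mul]
  refine this.symm.trans ?_
  change 𝓕⁻ (𝓕 (fun y => (Φ y : ℂ))) (x - z) = _
  rw [Real.fourierInv_eq, hF']
  refine integral_congr_ae (.of_forall fun y => ?_)
  simp only [Circle.smul_def, smul_eq_mul]
  ring

theorem norm_expSum_sq {d N : ℕ} (β : Fin N → ℂ) (x : Fin N → EuclideanSpace ℝ (Fin d))
    (ξ : EuclideanSpace ℝ (Fin d)) :
    ((‖expSum β x ξ‖ ^ 2 : ℝ) : ℂ) =
      ∑ i, ∑ j, β i * star (β j) * (𝐞 (inner ℝ ξ (x i - x j)) : ℂ) := by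
  rw [Complex.ofReal_pow, ← Complex.mul_conj', expSum, map_sum, Finset.sum_mul_sum]
  refine Finset.sum_congr rfl fun i _ => Finset.sum_congr rfl fun j _ => ?_
  rw [inner_sub_right, sub_eq_add_neg, AddChar.map_add_eq_mul, Circle.coe_mul,
    AddChar.map_neg_eq_inv, Circle.coe_inv_eq_conj, map_mul]
  simp only [Complex.star_def]
  ring

theorem IsSobolevKernel.quadForm_eq {d N : ℕ} {s : ℝ} (hs : (d : ℝ) / 2 < s)
    {k : EuclideanSpace ℝ (Fin d) → EuclideanSpace ℝ (Fin d) → ℝ} (hk : IsSobolevKernel k s)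
    (x : Fin N → EuclideanSpace ℝ (Fin d)) (a : Fin N → ℝ) :
    a ⬝ᵥ Matrix.mulVec (kernelMatrix k x) a = (2 * π) ^ ((d : ℝ) / 2) *
      ∫ ξ, sobolevWeight s ξ * ‖expSum (fun j => (a j : ℂ)) x ξ‖ ^ 2 := by
  have hI : ∀ z : EuclideanSpace ℝ (Fin d),
      Integrable fun ξ => (sobolevWeight s ξ : ℂ) * (𝐞 (inner ℝ ξ z) : ℂ) := fun z => by
    refine (integrable_sobolevWeight hs).ofReal.mul_bdd (c := 1) ?_
      (.of_forall fun ξ => (Circle.norm_coe _).le)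
    exact (continuous_subtype_val.comp
      (Real.continuous_fourierChar.comp (by fun_prop))).aestronglyMeasurable
  apply Complex.ofReal_injective
  rw [Complex.ofReal_mul, ← integral_complex_ofReal]
  simp_rw [Complex.ofReal_mul (sobolevWeight s _), norm_expSum_sq, Finset.mul_sum]
  rw [integral_finsetSum _ fun i _ => integrable_finsetSum _ fun j _ =>
    ((hI (x i - x j)).const_mul ((a i : ℂ) * star (a j : ℂ))).congr
      (.of_forall fun ξ => by simp only []; ring)]
  rw [Finset.mul_sum, dotProduct, Complex.ofReal_sum]
  refine Finset.sum_congr rfl fun i _ => ?_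
  rw [integral_finsetSum _ fun j _ =>
    ((hI (x i - x j)).const_mul ((a i : ℂ) * star (a j : ℂ))).congr
      (.of_forall fun ξ => by simp only []; ring)]
  rw [Finset.mul_sum, Matrix.mulVec, dotProduct, Finset.mul_sum, Complex.ofReal_sum]
  refine Finset.sum_congr rfl fun j _ => ?_
  have h1 : ∫ ξ, (sobolevWeight s ξ : ℂ) * ((a i : ℂ) * star (a j : ℂ) *
      (𝐞 (inner ℝ ξ (x i - x j)) : ℂ)) = (a i : ℂ) * (a j : ℂ) *
      ∫ ξ, (sobolevWeight s ξ : ℂ) * (𝐞 (inner ℝ ξ (x i - x j)) : ℂ) := by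
    rw [← integral_const_mul]
    refine integral_congr_ae (.of_forall fun ξ => ?_)
    simp only [Complex.star_def, Complex.conj_ofReal]
    ring
  rw [h1, kernelMatrix, Matrix.of_apply, Complex.ofReal_mul, Complex.ofReal_mul,
    hk.apply_eq_integral hs]
  ring

/-! ### Band-limited densities and the annihilated profile. -/

/-- There is a smooth function with support in the ball of radius `1 / 2` and positive integral. -/
theorem exists_schwartz_bump (d : ℕ) : ∃ χ : 𝓢(EuclideanSpace ℝ (Fin d), ℂ),
    (∀ z, 1 / 2 ≤ ‖z‖ → χ z = 0) ∧ 𝓕 χ 0 ≠ 0 := by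
  let b : ContDiffBump (0 : EuclideanSpace ℝ (Fin d)) := ⟨1 / 4, 1 / 2, by norm_num, by norm_num⟩
  have hcs : HasCompactSupport fun z => ((b z : ℝ) : ℂ) :=
    b.hasCompactSupport.comp_left Complex.ofReal_zero
  have hsm : ContDiff ℝ (⊤ : ℕ∞) fun z => ((b z : ℝ) : ℂ) :=
    Complex.ofRealCLM.contDiff.comp (g := Complex.ofRealCLM) b.contDiff
  have happ : ∀ z, hcs.toSchwartzMap hsm z = (b z : ℂ) := fun _ => rfl
  refine ⟨hcs.toSchwartzMap hsm, fun z hz => ?_, ?_⟩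
  · have : b z = 0 := b.zero_of_le_dist (by simpa [b] using hz)
    rw [happ, this, Complex.ofReal_zero]
  · simp only [SchwartzMap.fourier_coe, Real.fourier_eq, happ]
    have : ∫ z, (b z : ℂ) ≠ 0 := by
      rw [integral_complex_ofReal]
      exact_mod_cast (b.integral_pos (μ := volume)).ne'
    simpa using this

theorem MeasureTheory.Integrable.integrable_integral_mul_sub {d : ℕ}
    {v ρ : EuclideanSpace ℝ (Fin d) → ℝ} (hv : Integrable v) (hρ : Integrable ρ) :
    Integrable fun ξ => ∫ η, v η * ρ (ξ - η) :=
  hv.integrable_convolution (ContinuousLinearMap.mul ℝ ℝ) hρ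

/-- Averaging an admissible density against translates of a band-limited density. -/
theorem integral_convolution_mul_norm_expSum_sq {d N : ℕ}
    {v ρ : EuclideanSpace ℝ (Fin d) → ℝ} (hv : Integrable v) (hρ : Integrable ρ) {A : ℝ}
    (y : Fin N → EuclideanSpace ℝ (Fin d))
    (hA : ∀ β : Fin N → ℂ, ∫ ξ, ρ ξ * ‖expSum β y ξ‖ ^ 2 = A * ∑ j, ‖β j‖ ^ 2)
    (β : Fin N → ℂ) :
    ∫ ξ, (∫ η, v η * ρ (ξ - η)) * ‖expSum β y ξ‖ ^ 2 = (∫ η, v η) * A * ∑ j, ‖β j‖ ^ 2 := by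
  have h0 := Integrable.convolution_integrand (ContinuousLinearMap.mul ℝ ℝ) hv hρ
  have h1 : Integrable (Function.uncurry fun ξ η : EuclideanSpace ℝ (Fin d) =>
      v η * ρ (ξ - η) * ‖expSum β y ξ‖ ^ 2) (volume.prod volume) := by
    refine Integrable.mul_bdd (c := (∑ j, ‖β j‖) ^ 2) h0
      (((continuous_expSum β y).comp continuous_fst).norm.pow 2).aestronglyMeasurable
      (.of_forall fun p => ?_)
    rw [Real.norm_of_nonneg (sq_nonneg _)]
    exact pow_le_pow_left₀ (norm_nonneg _) (norm_expSum_le β y p.1) 2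
  simp_rw [← integral_mul_const]
  rw [integral_integral_swap h1]
  refine integral_congr_ae (.of_forall fun η => ?_)
  dsimp only
  simp_rw [mul_assoc]
  rw [integral_const_mul, ← integral_add_right_eq_self _ η]
  simp only [add_sub_cancel_right, expSum_add]
  rw [hA]
  simp only [norm_mul, Circle.norm_coe, mul_one]

/-- A nonnegative, rapidly decaying density whose Fourier transform lives in the unit ball. -/
theorem exists_bandlimited_density (d : ℕ) :
    ∃ ρ : EuclideanSpace ℝ (Fin d) → ℝ, Integrable ρ ∧ Continuous ρ ∧ (∀ ξ, 0 ≤ ρ ξ) ∧ 0 < ρ 0 ∧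
      (∀ m : ℕ, ∃ D : ℝ, ∀ ξ, (‖ξ‖ ^ m) ^ 2 * ρ ξ ≤ D ^ 2) ∧
      ∃ A : ℝ, ∀ (N : ℕ) (β : Fin N → ℂ) (y : Fin N → EuclideanSpace ℝ (Fin d)),
        (∀ i j, i ≠ j → 1 ≤ ‖y i - y j‖) →
          ∫ ξ, ρ ξ * ‖expSum β y ξ‖ ^ 2 = A * ∑ j, ‖β j‖ ^ 2 := by
  obtain ⟨χ, hχ, hχ0⟩ := exists_schwartz_bump d
  refine ⟨fun ξ => ‖𝓕 χ ξ‖ ^ 2, ?_, (𝓕 χ).continuous.norm.pow 2, fun ξ => by positivity,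
    by positivity, fun m => ?_, ∫ z, ‖χ z‖ ^ 2, fun N β y hy =>
      integral_norm_fourier_sq_mul_norm_expSum_sq χ hχ β y hy⟩
  · have := ((𝓕 χ).memLp 2).integrable_norm_pow (by norm_num)
    simpa using this
  · obtain ⟨D, -, hD⟩ := (𝓕 χ).decay m 0
    simp only [norm_iteratedFDeriv_zero] at hD
    refine ⟨D, fun ξ => ?_⟩
    rw [← mul_pow]
    exact pow_le_pow_left₀ (by positivity) (hD ξ) 2

/-- Every translate of `ρ` has the same integral against `|S|²`-type sums, since translation only
changes the phases of the coefficients. Hence `v * ρ - Vρ`, with `V = ∫ v`, integrates to zero. Far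
out `v * ρ` is at least of order `‖ξ‖^(-2s)`, while `ρ` decays rapidly, so the difference is
positive there. -/
theorem exists_bandlimited_profile (d : ℕ) {s : ℝ} (hs : (d : ℝ) / 2 < s) :
    ∃ (G : EuclideanSpace ℝ (Fin d) → ℝ) (M C : ℝ), Integrable G ∧ 0 < M ∧ 0 ≤ C ∧
      (∀ (N : ℕ) (β : Fin N → ℂ) (y : Fin N → EuclideanSpace ℝ (Fin d)),
        (∀ i j, i ≠ j → 1 ≤ ‖y i - y j‖) → ∫ ξ, G ξ * ‖expSum β y ξ‖ ^ 2 = 0) ∧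
      (∀ ξ, M ≤ ‖ξ‖ → ‖ξ‖ ^ (-(2 * s)) ≤ G ξ) ∧ ∀ ξ, -C ≤ G ξ := by
  have hs0 : 0 < s := lt_of_le_of_lt (by positivity) hs
  obtain ⟨ρ, hρ, hρc, hρ0, hρ1, hdecay, A, hρA⟩ := exists_bandlimited_density d
  set v : EuclideanSpace ℝ (Fin d) → ℝ := fun η => (1 + ‖η‖ ^ 2) ^ (-s)
  have hv : Integrable v := integrable_one_add_norm_sq_rpow hs
  have hv0 : ∀ η, 0 ≤ v η := fun η => Real.rpow_nonneg (by positivity) _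
  obtain ⟨k, hk⟩ := exists_nat_gt s
  obtain ⟨D₀, hD₀⟩ := hdecay 0
  -- Since `2(k+1) > 2s + 1`, one power of `‖ξ‖` is left over to absorb constants in `hhigh`.
  obtain ⟨D, hD⟩ := hdecay (k + 1)
  have hρb : ∀ ξ, ρ ξ ≤ D₀ ^ 2 := fun ξ => by simpa using hD₀ ξ
  set V := ∫ η, v η with hV
  have hV0 : 0 ≤ V := integral_nonneg hv0
  set a := ∫ ζ in Metric.closedBall (0 : EuclideanSpace ℝ (Fin d)) 1, ρ ζ with ha
  have ha0 : 0 < a := by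
    rw [ha, setIntegral_pos_iff_support_of_nonneg_ae (.of_forall hρ0) hρ.integrableOn]
    refine lt_of_lt_of_le (IsOpen.measure_pos volume (hρc.isOpen_support.inter Metric.isOpen_ball)
      ⟨0, hρ1.ne', Metric.mem_ball_self one_pos⟩)
      (measure_mono (Set.inter_subset_inter_right _ Metric.ball_subset_closedBall))
  have hconvI : ∀ ξ, Integrable fun ζ => v (ξ - ζ) * ρ ζ := fun ξ =>
    (hv.comp_sub_left ξ).mul_bdd (c := D₀ ^ 2) hρc.aestronglyMeasurable
      (.of_forall fun ζ => by rw [Real.norm_of_nonneg (hρ0 _)]; exact hρb ζ)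
  have hswap : ∀ ξ, ∫ η, v η * ρ (ξ - η) = ∫ ζ, v (ξ - ζ) * ρ ζ := fun ξ => by
    rw [← integral_sub_left_eq_self _ volume ξ]
    simp
  -- For `‖ζ‖ ≤ 1 ≤ ‖ξ‖`, `1 + ‖ξ - ζ‖² ≤ 1 + (2‖ξ‖)² ≤ 5‖ξ‖²`.
  set b := 5 ^ (-s) * a with hb
  have hb0 : 0 < b := by positivity
  have hlow : ∀ ξ, 1 ≤ ‖ξ‖ → b * ‖ξ‖ ^ (-(2 * s)) ≤ ∫ η, v η * ρ (ξ - η) := fun ξ hξ => by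
    rw [hswap]
    calc b * ‖ξ‖ ^ (-(2 * s)) = ∫ ζ in Metric.closedBall (0 : EuclideanSpace ℝ (Fin d)) 1,
          (5 * ‖ξ‖ ^ 2) ^ (-s) * ρ ζ := by
          rw [integral_const_mul, Real.mul_rpow (by norm_num) (by positivity),
            ← Real.rpow_natCast, ← Real.rpow_mul (norm_nonneg _), hb]
          push_cast
          rw [mul_neg]
          ring
      _ ≤ ∫ ζ in Metric.closedBall (0 : EuclideanSpace ℝ (Fin d)) 1, v (ξ - ζ) * ρ ζ := by
          refine setIntegral_mono_on (hρ.integrableOn.const_mul _) (hconvI ξ).integrableOn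
            measurableSet_closedBall fun ζ hζ => ?_
          refine mul_le_mul_of_nonneg_right ?_ (hρ0 ζ)
          refine Real.rpow_le_rpow_of_nonpos (by positivity) ?_ (by linarith)
          have h1 : ‖ζ‖ ≤ 1 := by simpa using hζ
          have h2 := norm_sub_le ξ ζ
          have h3 := norm_nonneg (ξ - ζ)
          nlinarith
      _ ≤ _ := setIntegral_le_integral (hconvI ξ) (.of_forall fun ζ =>
          mul_nonneg (hv0 _) (hρ0 _))
  have hhigh : ∀ ξ, 1 ≤ ‖ξ‖ → 2 * V * D ^ 2 / b ≤ ‖ξ‖ →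
      V * ρ ξ ≤ b / 2 * ‖ξ‖ ^ (-(2 * s)) := fun ξ h1 h2 => by
    have hp : 0 < ‖ξ‖ := by linarith
    have h3 := hD ξ
    have h4 : ‖ξ‖ * ‖ξ‖ ^ (2 * s) ≤ (‖ξ‖ ^ (k + 1)) ^ 2 := by
      nth_rw 1 [← Real.rpow_one ‖ξ‖]
      rw [← Real.rpow_add hp, ← pow_mul, ← Real.rpow_natCast]
      refine Real.rpow_le_rpow_of_exponent_le h1 ?_
      push_cast
      linarith
    rw [Real.rpow_neg hp.le, ← div_eq_mul_inv, le_div_iff₀ (by positivity)]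
    have h5 : ‖ξ‖ * ‖ξ‖ ^ (2 * s) * ρ ξ ≤ D ^ 2 :=
      (mul_le_mul_of_nonneg_right h4 (hρ0 ξ)).trans h3
    rw [div_le_iff₀ hb0] at h2
    have h6 : 2 * V * (‖ξ‖ * ‖ξ‖ ^ (2 * s) * ρ ξ) ≤ ‖ξ‖ * b :=
      (mul_le_mul_of_nonneg_left h5 (mul_nonneg zero_le_two hV0)).trans h2
    have h7 : ‖ξ‖ * (2 * V * ‖ξ‖ ^ (2 * s) * ρ ξ) ≤ ‖ξ‖ * b := by linarith
    have := le_of_mul_le_mul_left h7 hp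
    linarith
  have hcI : Integrable fun ξ => ∫ η, v η * ρ (ξ - η) := hv.integrable_integral_mul_sub hρ
  have hVA : ∀ A' B' : ℝ, (∫ η, v η) * A' * B' = V * A' * B' := fun _ _ => by rw [hV]
  clear_value V a b
  -- Subtracting `Vρ` uses up at most half of the lower bound `b‖ξ‖^(-2s)`; the factor `2/b`
  -- normalizes the remaining half.
  refine ⟨fun ξ => 2 / b * ((∫ η, v η * ρ (ξ - η)) - V * ρ ξ),
    max 1 (2 * V * D ^ 2 / b), 2 / b * (V * D₀ ^ 2), ?_, by positivity, by positivity, ?_, ?_, ?_⟩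
  · exact (hcI.sub (hρ.const_mul V)).const_mul _
  · intro N β y hy
    have hA : ∀ β : Fin N → ℂ, ∫ ξ, ρ ξ * ‖expSum β y ξ‖ ^ 2 = A * ∑ j, ‖β j‖ ^ 2 :=
      fun β => hρA N β y hy
    have h1 := integral_convolution_mul_norm_expSum_sq hv hρ y hA β
    have h2 : ∀ ξ, 2 / b * ((∫ η, v η * ρ (ξ - η)) - V * ρ ξ) * ‖expSum β y ξ‖ ^ 2 =
        2 / b * ((∫ η, v η * ρ (ξ - η)) * ‖expSum β y ξ‖ ^ 2 -
          V * (ρ ξ * ‖expSum β y ξ‖ ^ 2)) := fun ξ => by ring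
    simp_rw [h2]
    rw [integral_const_mul, integral_sub (hcI.mul_norm_expSum_sq β y)
      ((hρ.mul_norm_expSum_sq β y).const_mul V), integral_const_mul, h1, hA β, hVA]
    ring
  · intro ξ hξ
    have h1 := hlow ξ ((le_max_left _ _).trans hξ)
    have h2 := hhigh ξ ((le_max_left _ _).trans hξ) ((le_max_right _ _).trans hξ)
    have h3 : b / 2 * ‖ξ‖ ^ (-(2 * s)) ≤ (∫ η, v η * ρ (ξ - η)) - V * ρ ξ := by linarith
    calc ‖ξ‖ ^ (-(2 * s)) = 2 / b * (b / 2 * ‖ξ‖ ^ (-(2 * s))) := by field_simp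
      _ ≤ _ := mul_le_mul_of_nonneg_left h3 (by positivity)
  · intro ξ
    have h1 : 0 ≤ ∫ η, v η * ρ (ξ - η) :=
      integral_nonneg fun η => mul_nonneg (hv0 _) (hρ0 _)
    have h2 := mul_le_mul_of_nonneg_left (hρb ξ) hV0
    rw [← mul_neg]
    exact mul_le_mul_of_nonneg_left (by linarith) (by positivity)

/-! ### Bernstein inequality and monotonicity of the weights. -/

/-- Bernstein-type inequality for exponential sums with `δ`-separated nodes. -/
theorem exists_integral_sobolevWeight_le (d : ℕ) {s t : ℝ} (hs : (d : ℝ) / 2 < s) (hst : s ≤ t) :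
    ∃ C : ℝ, 0 < C ∧ ∀ (N : ℕ) (β : Fin N → ℂ) (x : Fin N → EuclideanSpace ℝ (Fin d)) (δ : ℝ),
      0 < δ → δ ≤ 1 → (∀ i j, i ≠ j → δ ≤ ‖x i - x j‖) →
        ∫ ξ, sobolevWeight s ξ * ‖expSum β x ξ‖ ^ 2 ≤
          C * δ ^ (-(2 * (t - s))) * ∫ ξ, sobolevWeight t ξ * ‖expSum β x ξ‖ ^ 2 := by
  have hs0 : 0 < s := lt_of_le_of_lt (by positivity) hs
  obtain ⟨G, M, C, hG, hM, hC, hG0, hGM, hGC⟩ := exists_bandlimited_profile d hs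
  set K := 1 + (2 * π * M) ^ 2 with hK
  have hK0 : 0 < K := by positivity
  refine ⟨(1 + C * K ^ s) * K ^ (t - s), by positivity, fun N β x δ hδ hδ1 hx => ?_⟩
  -- Rescaling frequencies by `δ` replaces the nodes by `δ⁻¹ • x j`, which are 1-separated.
  have hzero : ∫ ξ, G (δ • ξ) * ‖expSum β x ξ‖ ^ 2 = 0 := by
    have h1 := Measure.integral_comp_smul volume
      (fun ξ => G ξ * ‖expSum β (fun j => δ⁻¹ • x j) ξ‖ ^ 2) δ
    rw [hG0 N β _ fun i j hij => ?_, smul_zero] at h1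
    · rw [← h1]
      refine integral_congr_ae (.of_forall fun ξ => ?_)
      simp only [expSum_smul, smul_smul, mul_inv_cancel₀ hδ.ne', one_smul]
    · rw [← smul_sub, norm_smul, Real.norm_of_nonneg (by positivity), ← div_eq_inv_mul,
        le_div_iff₀ hδ, one_mul]
      exact hx i j hij
  -- For `‖δξ‖ ≥ M` the `G` term alone suffices. Otherwise `G ≥ -C` loses at most `Cδ^(2s) ≤ C K^s
  -- B^(-s)`, whence the factor `1 + C * K ^ s`; here `δ ≤ 1` gives `Bδ² ≤ K`.
  have hpt : ∀ ξ, sobolevWeight s ξ ≤ δ ^ (2 * s) * G (δ • ξ) +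
      (1 + C * K ^ s) * K ^ (t - s) * δ ^ (-(2 * (t - s))) * sobolevWeight t ξ := fun ξ => by
    have hnorm : ‖(2 * π) • ξ‖ = 2 * π * ‖ξ‖ := by
      rw [norm_smul, Real.norm_of_nonneg (by positivity)]
    have hδn : ‖δ • ξ‖ = δ * ‖ξ‖ := by rw [norm_smul, Real.norm_of_nonneg hδ.le]
    rcases le_total M ‖δ • ξ‖ with h | h
    · have h1 := hGM _ h
      have hp : 0 < ‖ξ‖ := by
        rw [hδn] at h
        exact pos_of_mul_pos_right (hM.trans_le h) hδ.le
      have h2 : sobolevWeight s ξ ≤ ‖ξ‖ ^ (-(2 * s)) := by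
        have : ‖ξ‖ ^ (-(2 * s)) = (‖ξ‖ ^ 2) ^ (-s) := by
          rw [← Real.rpow_natCast, ← Real.rpow_mul hp.le]
          push_cast
          rw [mul_neg]
        rw [this, sobolevWeight, hnorm]
        refine Real.rpow_le_rpow_of_nonpos (by positivity) ?_ (by linarith)
        have : (1 : ℝ) ≤ 2 * π := by linarith [Real.pi_gt_three]
        nlinarith [mul_le_mul_of_nonneg_right this hp.le, norm_nonneg ξ]
      have h3 : ‖ξ‖ ^ (-(2 * s)) = δ ^ (2 * s) * ‖δ • ξ‖ ^ (-(2 * s)) := by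
        rw [hδn, Real.mul_rpow hδ.le hp.le, ← mul_assoc, ← Real.rpow_add hδ, add_neg_cancel,
          Real.rpow_zero, one_mul]
      have h4 := mul_le_mul_of_nonneg_left h1 (Real.rpow_nonneg hδ.le (2 * s))
      have h5 : 0 ≤ (1 + C * K ^ s) * K ^ (t - s) * δ ^ (-(2 * (t - s))) * sobolevWeight t ξ :=
        mul_nonneg (by positivity) (sobolevWeight_nonneg _ _)
      linarith
    · set B := 1 + ‖(2 * π) • ξ‖ ^ 2 with hB
      have hB0 : 0 < B := by positivity
      have hBK : B * δ ^ 2 ≤ K := by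
        rw [hB, hK, hnorm]
        rw [hδn] at h
        have h1 : (δ * ‖ξ‖) ^ 2 ≤ M ^ 2 := pow_le_pow_left₀ (by positivity) h 2
        have h2 : δ ^ 2 ≤ 1 := pow_le_one₀ hδ.le hδ1
        nlinarith [mul_le_mul_of_nonneg_left h1 (sq_nonneg (2 * π))]
      have hδs : ∀ r : ℝ, δ ^ (2 * r) = (δ ^ 2) ^ r := fun r => by
        rw [Real.rpow_mul hδ.le, Real.rpow_two]
      have h1 : δ ^ (2 * s) ≤ K ^ s * B ^ (-s) := by
        rw [hδs, Real.rpow_neg hB0.le, ← div_eq_mul_inv, le_div_iff₀ (by positivity),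
          ← Real.mul_rpow (by positivity) hB0.le]
        exact Real.rpow_le_rpow (by positivity) (by linarith) hs0.le
      have h2 : B ^ (-s) ≤ K ^ (t - s) * δ ^ (-(2 * (t - s))) * B ^ (-t) := by
        have h3 : B ^ (-s) = B ^ (t - s) * B ^ (-t) := by
          rw [← Real.rpow_add hB0]
          congr 1
          ring
        rw [h3]
        refine mul_le_mul_of_nonneg_right ?_ (by positivity)
        rw [Real.rpow_neg hδ.le, ← div_eq_mul_inv, le_div_iff₀ (by positivity), hδs,
          ← Real.mul_rpow hB0.le (by positivity)]
        exact Real.rpow_le_rpow (by positivity) hBK (by linarith)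
      have h3 : -(C * δ ^ (2 * s)) ≤ δ ^ (2 * s) * G (δ • ξ) := by
        have := mul_le_mul_of_nonneg_left (hGC (δ • ξ)) (Real.rpow_nonneg hδ.le (2 * s))
        linarith
      have h4 := mul_le_mul_of_nonneg_left h1 hC
      have h5 := mul_le_mul_of_nonneg_left h2 (by positivity : 0 ≤ 1 + C * K ^ s)
      simp only [sobolevWeight, ← hB]
      linarith
  have hIG : Integrable fun ξ => G (δ • ξ) := hG.comp_smul hδ.ne'
  have hIs := (integrable_sobolevWeight hs).mul_norm_expSum_sq β x
  have hIt := (integrable_sobolevWeight (hs.trans_le hst)).mul_norm_expSum_sq β x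
  have hIg := hIG.mul_norm_expSum_sq β x
  calc ∫ ξ, sobolevWeight s ξ * ‖expSum β x ξ‖ ^ 2
      ≤ ∫ ξ, (δ ^ (2 * s) * (G (δ • ξ) * ‖expSum β x ξ‖ ^ 2) +
        (1 + C * K ^ s) * K ^ (t - s) * δ ^ (-(2 * (t - s))) *
          (sobolevWeight t ξ * ‖expSum β x ξ‖ ^ 2)) := by
        refine integral_mono hIs ((hIg.const_mul _).add (hIt.const_mul _)) fun ξ => ?_
        have := mul_le_mul_of_nonneg_right (hpt ξ) (sq_nonneg ‖expSum β x ξ‖)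
        dsimp only
        linarith
    _ = _ := by
        rw [integral_add (hIg.const_mul _) (hIt.const_mul _), integral_const_mul,
          integral_const_mul, hzero, mul_zero, zero_add]

theorem integral_sobolevWeight_anti {d N : ℕ} {s t : ℝ} (hs : (d : ℝ) / 2 < s) (hst : s ≤ t)
    (β : Fin N → ℂ) (x : Fin N → EuclideanSpace ℝ (Fin d)) :
    ∫ ξ, sobolevWeight t ξ * ‖expSum β x ξ‖ ^ 2 ≤ ∫ ξ, sobolevWeight s ξ * ‖expSum β x ξ‖ ^ 2 := by
  refine integral_mono ((integrable_sobolevWeight (hs.trans_le hst)).mul_norm_expSum_sq β x)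
    ((integrable_sobolevWeight hs).mul_norm_expSum_sq β x) fun ξ => ?_
  refine mul_le_mul_of_nonneg_right ?_ (sq_nonneg _)
  exact Real.rpow_le_rpow_of_exponent_le (le_add_of_nonneg_right (sq_nonneg _)) (by linarith)

/-! ### The Dirichlet eigenvalue and `c₀ ≥ 1`. -/

/-- Poincaré's inequality on the ball of radius `1 / 2`. -/
theorem integral_sq_le_integral_norm_fderiv_sq {d : ℕ} (hd : 0 < d)
    {u : EuclideanSpace ℝ (Fin d) → ℝ} (hu : ContDiff ℝ (⊤ : ℕ∞) u) (hc : HasCompactSupport u)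
    (hs : tsupport u ⊆ Metric.ball 0 (1 / 2)) :
    ∫ x, u x ^ 2 ≤ ∫ x, ‖fderiv ℝ u x‖ ^ 2 := by
  have hu1 : ContDiff ℝ 1 u := hu.of_le (by exact_mod_cast le_top)
  have hdu : Continuous (fderiv ℝ u) := hu1.continuous_fderiv one_ne_zero
  have hcd : HasCompactSupport (fderiv ℝ u) := hc.fderiv ℝ
  have huc := hu1.continuous
  obtain ⟨e, he⟩ : ∃ e : EuclideanSpace ℝ (Fin d), ‖e‖ = 1 :=
    ⟨EuclideanSpace.single ⟨0, hd⟩ 1, by simp⟩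
  obtain ⟨ℓ, hℓe, hℓ⟩ : ∃ ℓ : EuclideanSpace ℝ (Fin d) →L[ℝ] ℝ, ℓ e = 1 ∧ ∀ x, |ℓ x| ≤ ‖x‖ :=
    ⟨innerSL ℝ e, by simp [he], fun x => by simpa [he] using abs_real_inner_le_norm e x⟩
  have hu2d : ∀ x, fderiv ℝ (fun x => u x ^ 2) x e = 2 * u x * fderiv ℝ u x e := fun x => by
    rw [fderiv_fun_pow 2 (hu1.differentiable one_ne_zero x)]
    simp
  have hcs : HasCompactSupport fun x => u x ^ 2 := hc.comp_left (g := fun r => r ^ 2) (by simp)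
  have hI1 : Integrable fun x => u x ^ 2 := (huc.pow 2).integrable_of_hasCompactSupport hcs
  have hcd2 : HasCompactSupport fun x => ‖fderiv ℝ u x‖ ^ 2 :=
    hcd.comp_left (g := fun L => ‖L‖ ^ 2) (by simp)
  have hI2 : Integrable fun x => ‖fderiv ℝ u x‖ ^ 2 :=
    (hdu.norm.pow 2).integrable_of_hasCompactSupport hcd2
  have hdue : Continuous fun x => fderiv ℝ u x e := hdu.clm_apply continuous_const
  have hc3 : HasCompactSupport fun x => 2 * u x * fderiv ℝ u x e * ℓ x :=
    hc.mono fun x hx h => hx (by simp [h])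
  have hI3 : Integrable fun x => 2 * u x * fderiv ℝ u x e * ℓ x :=
    (((continuous_const.mul huc).mul hdue).mul ℓ.continuous).integrable_of_hasCompactSupport hc3
  have hc4 : HasCompactSupport fun x => u x ^ 2 * ℓ x :=
    hc.mono fun x hx h => hx (by simp [h])
  have hI4 : Integrable fun x => u x ^ 2 * ℓ x :=
    ((huc.pow 2).mul ℓ.continuous).integrable_of_hasCompactSupport hc4
  have hI5 : Integrable fun x => fderiv ℝ (fun x => u x ^ 2) x e * ℓ x := by
    simpa only [hu2d] using hI3
  have hI6 : Integrable fun x => u x ^ 2 * fderiv ℝ ℓ x e := by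
    simpa only [ContinuousLinearMap.fderiv, hℓe, mul_one] using hI1
  -- Integration by parts against the linear coordinate `ℓ` along `e`, for which `|ℓ| ≤ 1/2` on the
  -- ball.
  have key : ∫ x, u x ^ 2 * fderiv ℝ ℓ x e = -∫ x, fderiv ℝ (fun x => u x ^ 2) x e * ℓ x :=
    integral_mul_fderiv_eq_neg_fderiv_mul_of_integrable hI5 hI6 hI4
      (fun x _ => (hu1.differentiable one_ne_zero x).pow 2) (fun x _ => ℓ.differentiableAt)
  simp only [ContinuousLinearMap.fderiv, hℓe, mul_one, hu2d] at key
  have hpt : ∀ x, -(2 * u x * fderiv ℝ u x e * ℓ x) ≤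
      1 / 2 * u x ^ 2 + 1 / 2 * ‖fderiv ℝ u x‖ ^ 2 := fun x => by
    by_cases hx : x ∈ tsupport u
    · have h1 : |ℓ x| ≤ 1 / 2 := by
        have h2 : ‖x‖ < 1 / 2 := by simpa using hs hx
        exact (hℓ x).trans h2.le
      have h4 : |fderiv ℝ u x e| ≤ ‖fderiv ℝ u x‖ := by
        simpa [he] using (fderiv ℝ u x).le_opNorm e
      have h5 : |u x| * |fderiv ℝ u x e| * (2 * |ℓ x|) ≤ |u x| * ‖fderiv ℝ u x‖ * 1 := by
        gcongr
        linarith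
      have h6 := neg_abs_le (2 * u x * fderiv ℝ u x e * ℓ x)
      rw [abs_mul, abs_mul, abs_mul, abs_two] at h6
      nlinarith [sq_nonneg (|u x| - ‖fderiv ℝ u x‖), sq_abs (u x)]
    · rw [image_eq_zero_of_notMem_tsupport hx]
      simp only [mul_zero, zero_mul, neg_zero]
      positivity
  have hle : ∫ x, u x ^ 2 ≤ ∫ x, (1 / 2 * u x ^ 2 + 1 / 2 * ‖fderiv ℝ u x‖ ^ 2) := by
    rw [key, ← integral_neg]
    exact integral_mono hI3.neg ((hI1.const_mul _).add (hI2.const_mul _)) hpt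
  rw [integral_add (hI1.const_mul _) (hI2.const_mul _), integral_const_mul,
    integral_const_mul] at hle
  linarith

theorem one_le_dirichletEigenvalue {d : ℕ} (hd : 0 < d) : 1 ≤ dirichletEigenvalue d := by
  refine le_csInf ?_ ?_
  -- Nonemptiness matters: the real infimum of the empty set is 0.
  · let b : ContDiffBump (0 : EuclideanSpace ℝ (Fin d)) :=
      ⟨1 / 8, 1 / 4, by norm_num, by norm_num⟩
    refine ⟨_, b, b.contDiff, b.hasCompactSupport, ?_, fun h => ?_, rfl⟩
    · rw [b.tsupport_eq]
      exact Metric.closedBall_subset_ball (by norm_num [b])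
    · have h1 := b.one_of_mem_closedBall (Metric.mem_closedBall_self b.rIn_pos.le)
      rw [h] at h1
      simp at h1
  · rintro r ⟨u, hu, hc, hs, hne, rfl⟩
    have hpos : 0 < ∫ x, u x ^ 2 := by
      obtain ⟨x, hx⟩ := Function.ne_iff.1 hne
      refine (hu.continuous.pow 2).integral_pos_of_hasCompactSupport_nonneg_nonzero (x := x)
        (hc.comp_left (g := fun r => r ^ 2) (by simp)) (fun x => sq_nonneg _) ?_
      exact pow_ne_zero 2 hx
    rw [le_div_iff₀ hpos, one_mul]
    exact integral_sq_le_integral_norm_fderiv_sq hd hu hc hs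

theorem one_le_c0 {d : ℕ} (hd : 0 < d) : 1 ≤ c0 d := by
  have h1 : 1 ≤ √(2 : ℝ) := Real.one_le_sqrt.2 (by norm_num)
  have h2 := Real.one_le_sqrt.2 (one_le_dirichletEigenvalue hd)
  exact one_le_mul_of_one_le_of_one_le h1 h2

/-! ### Separation distance and comparison of Rayleigh quotients. -/

theorem sepDist_le {d N : ℕ} {x : Fin N → EuclideanSpace ℝ (Fin d)} (hx : Function.Injective x)
    {i j : Fin N} (hij : i ≠ j) : sepDist x ≤ ‖x i - x j‖ :=
  csInf_le ⟨0, by rintro r ⟨i, j, -, rfl⟩; exact norm_nonneg _⟩ ⟨i, j, hx.ne hij, rfl⟩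

theorem sepDist_pos {d N : ℕ} {x : Fin N → EuclideanSpace ℝ (Fin d)} (hx : Function.Injective x)
    (hN : 2 ≤ N) : 0 < sepDist x := by
  have hne : {r : ℝ | ∃ i j : Fin N, x i ≠ x j ∧ r = ‖x i - x j‖}.Nonempty :=
    ⟨_, ⟨0, by omega⟩, ⟨1, by omega⟩, hx.ne (by simp), rfl⟩
  have hfin : {r : ℝ | ∃ i j : Fin N, x i ≠ x j ∧ r = ‖x i - x j‖}.Finite :=
    (Set.finite_range fun p : Fin N × Fin N => ‖x p.1 - x p.2‖).subset (by
      rintro r ⟨i, j, -, rfl⟩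
      exact ⟨(i, j), rfl⟩)
  obtain ⟨i, j, hij, h⟩ := hne.csInf_mem hfin
  rw [sepDist, h]
  exact norm_pos_iff.2 (sub_ne_zero.2 hij)

theorem rayleigh_kernelMatrix_anti {d N : ℕ} {s t : ℝ} (hs : (d : ℝ) / 2 < s) (hst : s ≤ t)
    {k kσ : EuclideanSpace ℝ (Fin d) → EuclideanSpace ℝ (Fin d) → ℝ}
    (hk : IsSobolevKernel k t) (hkσ : IsSobolevKernel kσ s)
    (x : Fin N → EuclideanSpace ℝ (Fin d)) (α : EuclideanSpace ℝ (Fin N)) :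
    rayleigh (kernelMatrix k x) α ≤ rayleigh (kernelMatrix kσ x) α := by
  rw [rayleigh, rayleigh, hk.quadForm_eq (hs.trans_le hst), hkσ.quadForm_eq hs]
  have := integral_sobolevWeight_anti hs hst (fun j => (α.ofLp j : ℂ)) x
  gcongr

theorem IsSobolevKernel.rayleigh_nonneg {d N : ℕ} {s : ℝ} (hs : (d : ℝ) / 2 < s)
    {k : EuclideanSpace ℝ (Fin d) → EuclideanSpace ℝ (Fin d) → ℝ} (hk : IsSobolevKernel k s)
    (x : Fin N → EuclideanSpace ℝ (Fin d)) (α : EuclideanSpace ℝ (Fin N)) :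
    0 ≤ rayleigh (kernelMatrix k x) α := by
  rw [rayleigh, hk.quadForm_eq hs]
  have : 0 ≤ ∫ ξ, sobolevWeight s ξ * ‖expSum (fun j => (α.ofLp j : ℂ)) x ξ‖ ^ 2 :=
    integral_nonneg fun ξ => mul_nonneg (sobolevWeight_nonneg _ _) (sq_nonneg _)
  positivity

/-- The Rayleigh quotients of two Sobolev kernel matrices are comparable up to a power of the
separation distance, truncated at `1`. -/
theorem exists_rayleigh_kernelMatrix_le (d : ℕ) {s t : ℝ} (hs : (d : ℝ) / 2 < s) (hst : s ≤ t) :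
    ∃ C : ℝ, 0 < C ∧
      ∀ k kσ : EuclideanSpace ℝ (Fin d) → EuclideanSpace ℝ (Fin d) → ℝ,
        IsSobolevKernel k t → IsSobolevKernel kσ s →
        ∀ (N : ℕ) (x : Fin N → EuclideanSpace ℝ (Fin d)), Function.Injective x → 2 ≤ N →
          ∀ α : EuclideanSpace ℝ (Fin N), rayleigh (kernelMatrix kσ x) α ≤
            C * (min (sepDist x) 1) ^ (-(2 * (t - s))) * rayleigh (kernelMatrix k x) α := by
  obtain ⟨C, hC, h⟩ := exists_integral_sobolevWeight_le d hs hst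
  refine ⟨C, hC, fun k kσ hk hkσ N x hx hN α => ?_⟩
  have h1 := h N (fun j => (α.ofLp j : ℂ)) x (min (sepDist x) 1)
    (lt_min (sepDist_pos hx hN) one_pos) (min_le_right _ _)
    fun i j hij => (min_le_left _ _).trans (sepDist_le hx hij)
  rw [rayleigh, rayleigh, hk.quadForm_eq (hs.trans_le hst), hkσ.quadForm_eq hs, ← mul_div_assoc,
    mul_left_comm]
  gcongr

/-- After taking the `r`-th root: for `q ≤ 1` this is `1 ≤ q² + c²`, and for `q ≥ 1` it is `q² ≤ q²
+ c²`. The former is where `c₀ ≥ 1` enters. -/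
theorem min_one_rpow_le {q c r : ℝ} (hq : 0 < q) (hc : 1 ≤ c) (hr : 0 ≤ r) :
    (min q 1) ^ (-(2 * r)) ≤ (q ^ 2 + c ^ 2) ^ r * q ^ (-(2 * r)) := by
  have hm : 0 < min q 1 := lt_min hq one_pos
  have hqr : q ^ (-(2 * r)) = ((q ^ 2)⁻¹) ^ r := by
    rw [Real.rpow_neg hq.le, Real.rpow_mul hq.le, Real.rpow_two, Real.inv_rpow (sq_nonneg q)]
  have hmr : (min q 1) ^ (-(2 * r)) = (((min q 1) ^ 2)⁻¹) ^ r := by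
    rw [Real.rpow_neg hm.le, Real.rpow_mul hm.le, Real.rpow_two,
      Real.inv_rpow (sq_nonneg (min q 1))]
  rw [hqr, hmr, ← Real.mul_rpow (by positivity) (by positivity)]
  refine Real.rpow_le_rpow (by positivity) ?_ hr
  have hc2 : 1 ≤ c ^ 2 := one_le_pow₀ hc
  rw [← div_eq_mul_inv, le_div_iff₀ (by positivity)]
  rcases le_total q 1 with h | h
  · rw [min_eq_left h, inv_mul_cancel₀ (by positivity)]
    nlinarith [sq_nonneg q]
  · rw [min_eq_right h]
    nlinarith

theorem mainTheorem1 (d : ℕ) (hd : 0 < d) (τ σ : ℝ) (hτ : (d : ℝ) / 2 < τ)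
    (hσ : (d : ℝ) / (2 * τ) < σ) (hσ1 : σ ≤ 1)
    (Ω : Set (EuclideanSpace ℝ (Fin d))) :
    (∃ c : ℝ, 0 < c ∧
      ∀ k kσ : EuclideanSpace ℝ (Fin d) → EuclideanSpace ℝ (Fin d) → ℝ,
        IsSobolevKernel k τ → IsSobolevKernel kσ (σ * τ) →
        ∀ (N : ℕ) (x : Fin N → EuclideanSpace ℝ (Fin d)),
          Function.Injective x → (∀ i, x i ∈ Ω) →
          ∀ α : EuclideanSpace ℝ (Fin N), α ≠ 0 →
            rayleigh (kernelMatrix k x) α ≤ rayleigh (kernelMatrix kσ x) α ∧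
            (2 ≤ N →
              rayleigh (kernelMatrix kσ x) α ≤
                c * (sepDist x ^ 2 + c0 d ^ 2) ^ ((1 - σ) * τ)
                  * sepDist x ^ (-(2 * (1 - σ) * τ)) * rayleigh (kernelMatrix k x) α)) ∧
    (Bornology.IsBounded Ω →
      ∃ c' : ℝ, 0 < c' ∧
        ∀ k kσ : EuclideanSpace ℝ (Fin d) → EuclideanSpace ℝ (Fin d) → ℝ,
          IsSobolevKernel k τ → IsSobolevKernel kσ (σ * τ) →
          ∀ (N : ℕ) (x : Fin N → EuclideanSpace ℝ (Fin d)),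
            Function.Injective x → (∀ i, x i ∈ Ω) →
            ∀ α : EuclideanSpace ℝ (Fin N), α ≠ 0 →
              rayleigh (kernelMatrix k x) α ≤ rayleigh (kernelMatrix kσ x) α ∧
              (2 ≤ N →
                rayleigh (kernelMatrix kσ x) α ≤
                  c' * sepDist x ^ (-(2 * (1 - σ) * τ)) * rayleigh (kernelMatrix k x) α)) := by
  have hτ0 : 0 < τ := lt_of_le_of_lt (by positivity) hτ
  have hs : (d : ℝ) / 2 < σ * τ := by
    rw [div_lt_iff₀ (by positivity)] at hσ
    linarith
  have hst : σ * τ ≤ τ := mul_le_of_le_one_left hτ0.le hσ1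
  have hr : 0 ≤ (1 - σ) * τ := mul_nonneg (by linarith) hτ0.le
  obtain ⟨C, hC, h⟩ := exists_rayleigh_kernelMatrix_le d hs hst
  have hmain : ∀ k kσ : EuclideanSpace ℝ (Fin d) → EuclideanSpace ℝ (Fin d) → ℝ,
      IsSobolevKernel k τ → IsSobolevKernel kσ (σ * τ) →
      ∀ (N : ℕ) (x : Fin N → EuclideanSpace ℝ (Fin d)), Function.Injective x → 2 ≤ N →
        ∀ α : EuclideanSpace ℝ (Fin N), rayleigh (kernelMatrix kσ x) α ≤
          C * (sepDist x ^ 2 + c0 d ^ 2) ^ ((1 - σ) * τ)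
            * sepDist x ^ (-(2 * (1 - σ) * τ)) * rayleigh (kernelMatrix k x) α := by
    intro k kσ hk hkσ N x hx hN α
    refine (h k kσ hk hkσ N x hx hN α).trans
      (mul_le_mul_of_nonneg_right ?_ (hk.rayleigh_nonneg hτ x α))
    have hexp : τ - σ * τ = (1 - σ) * τ := by ring
    rw [hexp, mul_assoc C, mul_assoc 2]
    exact mul_le_mul_of_nonneg_left (min_one_rpow_le (sepDist_pos hx hN) (one_le_c0 hd) hr) hC.le
  refine ⟨⟨C, hC, fun k kσ hk hkσ N x hx _ α _ =>
    ⟨rayleigh_kernelMatrix_anti hs hst hk hkσ x α, fun hN => hmain k kσ hk hkσ N x hx hN α⟩⟩,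
    fun hΩ => ?_⟩
  -- Keeps the constant below positive even when `Ω` has diameter 0; it arises from bounding `q_X`
  -- by the diameter.
  have hc0 : 0 < c0 d := one_pos.trans_le (one_le_c0 hd)
  refine ⟨C * (Metric.diam Ω ^ 2 + c0 d ^ 2) ^ ((1 - σ) * τ), by positivity,
    fun k kσ hk hkσ N x hx hxΩ α _ =>
      ⟨rayleigh_kernelMatrix_anti hs hst hk hkσ x α, fun hN => ?_⟩⟩
  refine (hmain k kσ hk hkσ N x hx hN α).trans
    (mul_le_mul_of_nonneg_right ?_ (hk.rayleigh_nonneg hτ x α))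
  have hq := sepDist_pos hx hN
  have hqd : sepDist x ≤ Metric.diam Ω := by
    refine (sepDist_le hx (i := ⟨0, by omega⟩) (j := ⟨1, by omega⟩) (by simp)).trans ?_
    rw [← dist_eq_norm]
    exact Metric.dist_le_diam_of_mem hΩ (hxΩ _) (hxΩ _)
  gcongr
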